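/- **Setting.** Let $X$ be a set, $n\ge 1$, and let a sample be a tuple $S=((x_1,y_1),\dots,(x_n,y_n))\in(X\times\{\pm1\})^n$; two samples are neighboring, $S\sim S'$, if they differ in exactly one position. Randomized algorithms have discretely distributed outputs (which is automatic for outputs $X\to\{\pm1\}$ when $X=\{0,1\}^r$). A randomized computation $M$ on samples is $(\epsilon,\delta)$-DP if $\Pr[M(S)\in A]\le e^{\epsilon}\Pr[M(S')\in A]+\delta$ for all $S\sim S'$ and all sets $A$ of outcomes. A learner $L$ maps a sample $S$ and a probability distribution $\mu$ on $[n]$ to a random hypothesis $L(S,\mu):X\to\{\pm1\}$. It is $(\epsilon,\delta,\zeta)$-DP if $\Pr[L(S,\mu)\in A]\le e^{\epsilon}\Pr[L(S',\mu')\in A]+\delta$ for all $S\sim S'$, all distributions $\mu,\mu'$ on $[n]$ with $\max_{B\subseteq[n]}|\mu(B)-\mu'(B)|<\zeta$, and all sets $A$ of hypotheses. It is a weak learner with advantage $\gamma$ and failure probability $\beta$ for a concept class $\mathcal H$ of functions $X\to\{\pm1\}$ if for every sample $S$ labelled by some $c\in\mathcal H$ (that is, $y_i=c(x_i)$ for all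 $i$) and every distribution $\mu$ on $[n]$, except with probability at most $\beta$ the hypothesis $h=L(S,\mu)$ satisfies $\mu(\{i: h(x_i)=y_i\})\ge \tfrac12+\gamma$. **Algorithm `LazyBB`** (parameters $\kappa\in(0,1)$, $\lambda$, $\tau\in\mathbb N$; learner $L$; input $S$). Let $\Gamma$ be the set of $\kappa$-dense measures, i.e. of $\mu:[n]\to[0,1]$ with $\sum_i\mu(i)\ge\kappa n$, and let $\mu_1(i)=\kappa$ for all $i$. In round $t=1,\dots,\tau$ let $\hat\mu_t=\mu_t/\sum_i\mu_t(i)$, draw $h_t\sim L(S,\hat\mu_t)$ with fresh randomness, put $\tilde\mu_{t+1}(i)=\kappa\exp\bigl(-\lambda\, y_i\sum_{j\le t}h_j(x_i)\bigr)$, and let $$\mu_{t+1}=\arg\min_{\mu\in\Gamma}\ \sum_{i}\Bigl(\mu(i)\ln\frac{\mu(i)}{\tilde\mu_{t+1}(i)}+\tilde\mu_{t+1}(i)-\mu(i)\Bigr)$$ be the Bregman projection of $\tilde\mu_{t+1}$ onto $\Gamma$. The output is the majority vote of the ensemble $h_1,\dots,h_\tau$ (ties give $+1$). **Theorem.** Let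 $\kappa\in(0,1)$, $\gamma>0$, $\epsilon_b,\delta_b\ge0$, and let $L$ be an $(\epsilon_b,\delta_b,1/(\kappa n))$-DP weak learner with advantage $\gamma$ and failure probability $\beta$ for $\mathcal H$. Run `LazyBB` with $L$ and $\lambda=\gamma/4$ for $\tau\ge 16\ln(1/\kappa)/\gamma^2$ rounds. * *Privacy.* For every $\delta'>0$ (where the square root is read as $0$ if $\delta'>1$), the map from $S$ to the ensemble $(h_1,\dots,h_\tau)$ and the map from $S$ to the output of `LazyBB` are $(\epsilon_A,\delta_A)$-DP with $$\epsilon_A=\sqrt{2\tau\ln(1/\delta')}\,\epsilon_b+\tau\epsilon_b(e^{\epsilon_b}-1),\qquad \delta_A=\tau\delta_b+\delta'.$$ * *Utility.* For every sample $S$ labelled by a concept of $\mathcal H$, except with probability at most $\tau\beta$ over the run of `LazyBB`, $$\frac1n\,\#\Bigl\{i\in[n]:\ \frac{y_i}{\tau}\sum_{j=1}^{\tau}h_j(x_i)\le\gamma\Bigr\}\le\kappa .$$ -/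

import Mathlib

namespace PrivateBoosting

/-- A sample of `n` labelled examples; labels are `±1`, encoded as the units of `ℤ`. -/
abbrev Sample (X : Type*) (n : ℕ) := Fin n → X × ℤˣ

/-- Probability distributions on `[n]`. -/
abbrev Dist (n : ℕ) := stdSimplex ℝ (Fin n)

/-- Two samples are neighboring if they differ in a single record. -/
def Neighboring {X : Type*} {n : ℕ} (S S' : Sample X n) : Prop :=
  ∃ i, S i ≠ S' i ∧ ∀ j, j ≠ i → S j = S' j

/-- Statistical (total variation) distance: the maximum of `|μ(A) - ν(A)|` over the events `A`. -/
noncomputable def statDist {n : ℕ} (μ ν : Dist n) : ℝ :=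
  ⨆ A : Finset (Fin n), |∑ i ∈ A, μ.1 i - ∑ i ∈ A, ν.1 i|

/-- `(ε, δ)`-indistinguishability, in one direction, of two discrete distributions. -/
def DPClose {Ω : Type*} (ε δ : ℝ) (p q : PMF Ω) : Prop :=
  ∀ A : Set Ω, p.toOuterMeasure A ≤
    ENNReal.ofReal (Real.exp ε) * q.toOuterMeasure A + ENNReal.ofReal δ

/-- `(ε, δ)`-differential privacy of a randomized computation on samples of size `n`. -/
def IsDP {X Ω : Type*} {n : ℕ} (M : Sample X n → PMF Ω) (ε δ : ℝ) : Prop :=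
  ∀ S S' : Sample X n, Neighboring S S' → DPClose ε δ (M S) (M S')

/-- A randomized algorithm which, given a sample and a distribution on its indices, outputs a
hypothesis `X → {±1}`. -/
abbrev Learner (X : Type*) (n : ℕ) := Sample X n → Dist n → PMF (X → ℤˣ)

/-- `(ε, δ, ζ)`-differential privacy of a weak learner. -/
def IsDPLearner {X : Type*} {n : ℕ} (L : Learner X n) (ε δ ζ : ℝ) : Prop :=
  ∀ S S' : Sample X n, Neighboring S S' → ∀ μ μ' : Dist n, statDist μ μ' < ζ →
    DPClose ε δ (L S μ) (L S' μ')

/-- The probability, for an index drawn from `μ`, that `h` predicts the label correctly. -/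
noncomputable def accuracy {X : Type*} {n : ℕ} (S : Sample X n) (μ : Dist n) (h : X → ℤˣ) : ℝ :=
  ∑ i with h (S i).1 = (S i).2, μ.1 i

/-- `L` is a weak learner for the concept class `C` with advantage `γ` and failure probability `β`:
on every sample labelled by a concept of `C` and for every distribution on the sample, the
hypothesis has accuracy at least `1/2 + γ`, except with probability at most `β`. -/
def IsWeakLearner {X : Type*} {n : ℕ} (L : Learner X n) (C : Set (X → ℤˣ)) (γ β : ℝ) : Prop :=
  ∀ S : Sample X n, (∃ c ∈ C, ∀ i, (S i).2 = c (S i).1) → ∀ μ : Dist n,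
    (L S μ).toOuterMeasure {h | ¬ 1 / 2 + γ ≤ accuracy S μ h} ≤ ENNReal.ofReal β

/-- The margin `y ∑ⱼ hⱼ(x)` of an ensemble on an example. -/
def margin {X : Type*} {t : ℕ} (H : Fin t → X → ℤˣ) (z : X × ℤˣ) : ℤ :=
  (z.2 : ℤ) * ∑ j, (H j z.1 : ℤ)

/-- The majority vote of an ensemble; ties are resolved as `+1`. -/
def majority {X : Type*} {t : ℕ} (H : Fin t → X → ℤˣ) : X → ℤˣ :=
  fun x => if 0 ≤ ∑ j, (H j x : ℤ) then 1 else -1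

/-- The `κ`-dense measures on `[n]`: functions with values in `[0, 1]` and total mass at
least `κ n`. -/
def denseMeasures (n : ℕ) (κ : ℝ) : Set (Fin n → ℝ) :=
  {μ | (∀ i, μ i ∈ Set.Icc (0 : ℝ) 1) ∧ κ * n ≤ ∑ i, μ i}

/-- Kullback-Leibler divergence of measures that need not have total mass one, that is, the Bregman
divergence of `μ ↦ ∑ i, (μ i * log (μ i) - μ i)`. -/
noncomputable def klMeasure {n : ℕ} (μ ν : Fin n → ℝ) : ℝ :=
  ∑ i, (μ i * Real.log (μ i / ν i) + ν i - μ i)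

theorem continuous_klMeasure {n : ℕ} (ν : Fin n → ℝ) :
    Continuous fun μ : Fin n → ℝ => klMeasure μ ν := by
  unfold klMeasure
  refine continuous_finsetSum _ fun i _ => ?_
  refine Continuous.sub (Continuous.add ?_ continuous_const) (continuous_apply i)
  by_cases hν : ν i = 0
  · simp [hν, continuous_const]
  · have h : (fun μ : Fin n → ℝ => μ i * Real.log (μ i / ν i)) =
        fun μ => ν i * ((μ i / ν i) * Real.log (μ i / ν i)) := by
      funext μ
      field_simp
    rw [h]
    have h2 : Continuous fun μ : Fin n → ℝ => μ i / ν i := (continuous_apply i).div_const _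
    exact continuous_const.mul (Real.continuous_mul_log.comp h2)

theorem isCompact_denseMeasures (n : ℕ) (κ : ℝ) : IsCompact (denseMeasures n κ) := by
  have h : denseMeasures n κ =
      (Set.univ.pi fun _ : Fin n => Set.Icc (0 : ℝ) 1) ∩ {μ | κ * n ≤ ∑ i, μ i} := by
    ext μ
    simp only [denseMeasures, Set.mem_setOf_eq, Set.mem_inter_iff, Set.mem_univ_pi]
  rw [h]
  exact (isCompact_univ_pi fun _ => isCompact_Icc).inter_right
    (isClosed_le continuous_const (continuous_finsetSum _ fun i _ => continuous_apply i))

theorem const_mem_denseMeasures (n : ℕ) (κ : Set.Ioo (0 : ℝ) 1) :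
    (fun _ => (κ : ℝ)) ∈ denseMeasures n κ :=
  ⟨fun _ => ⟨κ.2.1.le, κ.2.2.le⟩, by simp [mul_comm]⟩

theorem exists_bregmanProj (n : ℕ) (κ : Set.Ioo (0 : ℝ) 1) (ν : Fin n → ℝ) :
    ∃ μ ∈ denseMeasures n κ, ∀ μ' ∈ denseMeasures n κ, klMeasure μ ν ≤ klMeasure μ' ν :=
  (isCompact_denseMeasures n κ).exists_isMinOn ⟨_, const_mem_denseMeasures n κ⟩
    (continuous_klMeasure ν).continuousOn

/-- The Bregman projection of `ν` onto the `κ`-dense measures: a minimizer of the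
Kullback-Leibler divergence to `ν`. -/
noncomputable def bregmanProj (n : ℕ) (κ : Set.Ioo (0 : ℝ) 1) (ν : Fin n → ℝ) :
    denseMeasures n κ :=
  ⟨(exists_bregmanProj n κ ν).choose, (exists_bregmanProj n κ ν).choose_spec.1⟩

/-- Normalization of a `κ`-dense measure to a probability distribution. -/
noncomputable def normalize {n : ℕ} [NeZero n] {κ : Set.Ioo (0 : ℝ) 1}
    (μ : denseMeasures n κ) : Dist n :=
  ⟨fun i => μ.1 i / ∑ j, μ.1 j, by
    have hn : (0 : ℝ) < n := by exact_mod_cast Nat.pos_of_ne_zero (NeZero.ne n)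
    have hs : 0 < ∑ j, μ.1 j := lt_of_lt_of_le (mul_pos κ.2.1 hn) μ.2.2
    refine ⟨fun i => div_nonneg (μ.2.1 i).1 hs.le, ?_⟩
    rw [← Finset.sum_div, div_self hs.ne']⟩

/-- The measure that `LazyBB` holds after the hypotheses `H 0, …, H (t - 1)` were obtained. -/
noncomputable def lazyMeasure {X : Type*} {n : ℕ} (κ : Set.Ioo (0 : ℝ) 1) (lam : ℝ)
    (S : Sample X n) : (t : ℕ) → (Fin t → X → ℤˣ) → denseMeasures n κ
  | 0, _ => ⟨fun _ => κ, const_mem_denseMeasures n κ⟩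
  | _ + 1, H => bregmanProj n κ fun i => Real.exp (-lam * margin H (S i)) * κ

/-- The law of the ensemble `h₁, …, h_t` obtained in the first `t` rounds of `LazyBB`. -/
noncomputable def lazyEnsemble {X : Type*} {n : ℕ} [NeZero n] (κ : Set.Ioo (0 : ℝ) 1) (lam : ℝ)
    (L : Learner X n) (S : Sample X n) : (t : ℕ) → PMF (Fin t → X → ℤˣ)
  | 0 => PMF.pure Fin.elim0
  | t + 1 => (lazyEnsemble κ lam L S t).bind fun H =>
      (L S (normalize (lazyMeasure κ lam S t H))).map fun h => Fin.snoc H h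

/-- The law of the output of `LazyBB` after `τ` rounds: the majority vote of the ensemble. -/
noncomputable def lazyBB {X : Type*} {n : ℕ} [NeZero n] (κ : Set.Ioo (0 : ℝ) 1) (lam : ℝ) (τ : ℕ)
    (L : Learner X n) (S : Sample X n) : PMF (X → ℤˣ) :=
  (lazyEnsemble κ lam L S τ).map majority

/-- The fraction of the examples of `S` on which the normalized margin of `H` is at most `θ`. -/
noncomputable def lowMarginFraction {X : Type*} {n t : ℕ} (S : Sample X n) (H : Fin t → X → ℤˣ)
    (θ : ℝ) : ℝ :=
  (Finset.univ.filter fun i => (margin H (S i) : ℝ) / t ≤ θ).card / n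

end PrivateBoosting

namespace PrivateBoosting

open scoped ENNReal

/-! ### Scalar inequalities -/

/-! Privacy. With the earlier hypotheses fixed, the measures of neighboring samples are Bregman
projections of weights that differ at one index `i`. Such a projection is `min 1 (c * ν)`, with `c >
1` only if its mass is exactly `κ n`. Raising `ν i` therefore lowers every other coordinate weakly
and does not lower the total mass. After normalization all mass moves towards `i`, which holds at
most `1 / (κ n)`, so the learner's guarantee applies in each round and in both directions. The
rounds are composed through moments of the likelihood ratio (`HasMomentBound`): lost mass adds up
and moments multiply. A single round is no worse than randomized response
(`DPClose.hasMomentBound`), by convexity of `r ^ (l + 1)`, and a Markov argument with the optimal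
order `l` returns to `(ε, δ)`.

Utility. Up to a constant, `lazyObjective` is relative entropy to the uniform measure `κ` plus `lam`
times the margins integrated against `x`. If every round has advantage `γ`, the Pythagorean
inequality makes its minimum over dense measures grow by at least `lam * (2 * γ - lam) * κ n` per
round. If more than `κ n` examples had normalized margin at most `γ`, mass `κ n` spread evenly over
them would give a value that is too small. A union bound over the rounds accounts for failures of
the learner. -/

theorem sinh_le_mul_cosh {s : ℝ} (hs : 0 ≤ s) : Real.sinh s ≤ s * Real.cosh s := by
  rcases hs.eq_or_lt with rfl | hs
  · simp
  obtain ⟨c, hc, h⟩ := exists_hasDerivAt_eq_slope Real.sinh Real.cosh hs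
    Real.continuous_sinh.continuousOn fun x _ => Real.hasDerivAt_sinh x
  have hcs : Real.cosh c ≤ Real.cosh s := by
    rw [Real.cosh_le_cosh, abs_of_pos hc.1, abs_of_pos hs]
    exact hc.2.le
  rw [h, Real.sinh_zero, sub_zero, sub_zero, div_le_iff₀ hs] at hcs
  linarith

/-- The moment of the privacy loss of randomized response. -/
theorem randomizedResponse_moment_le {ε s : ℝ} (hε : 0 ≤ ε) (hs : 0 ≤ s) :
    (Real.exp ε * Real.exp s + Real.exp (-s)) / (1 + Real.exp ε) ≤
      Real.exp (s * (Real.exp ε - 1) + s ^ 2 / 2) := by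
  have hE : 1 ≤ Real.exp ε := Real.one_le_exp hε
  set E := Real.exp ε
  have h1 : (E * Real.exp s + Real.exp (-s)) / (1 + E) =
      Real.cosh s + (E - 1) / (1 + E) * Real.sinh s := by
    rw [Real.cosh_eq, Real.sinh_eq]
    field_simp
    ring
  have hsinh : 0 ≤ Real.sinh s := Real.sinh_nonneg_iff.2 hs
  have hc : (E - 1) / (1 + E) ≤ E - 1 := div_le_self (by linarith) (by linarith)
  calc _ ≤ Real.cosh s + (E - 1) * (s * Real.cosh s) := by
        rw [h1]
        gcongr
        exact sinh_le_mul_cosh hs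
    _ = (s * (E - 1) + 1) * Real.cosh s := by ring
    _ ≤ Real.exp (s * (E - 1)) * Real.exp (s ^ 2 / 2) := by
        gcongr
        · exact Real.add_one_le_exp _
        · exact Real.cosh_le_exp_half_sq s
    _ = _ := (Real.exp_add _ _).symm

/-- On `[E⁻¹, E]`, the power `r ^ (l + 1)` lies below its chord `a * r - b`, where `0 ≤ b`. -/
theorem exists_chord_bound {E l : ℝ} (hE : 1 < E) (hl : 0 ≤ l) :
    ∃ a b : ℝ, 0 ≤ b ∧ b ≤ a ∧ a - b = (E * E ^ l + E ^ (-l)) / (1 + E) ∧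
      (b ≤ a * E⁻¹) ∧
      ∀ r, E⁻¹ ≤ r → r ≤ E → r ^ (l + 1) ≤ a * r - b := by
  have hE0 : 0 < E := by linarith
  have hinv : E⁻¹ < 1 := inv_lt_one_of_one_lt₀ hE
  have hD : 0 < E - E⁻¹ := by linarith
  set u := E ^ l with hu
  set v := E ^ (-l) with hv
  have hu1 : 1 ≤ u := Real.one_le_rpow hE.le hl
  have hv1 : v ≤ 1 := Real.rpow_le_one_of_one_le_of_nonpos hE.le (by linarith)
  have hv0 : 0 < v := Real.rpow_pos_of_pos hE0 _
  have huE : E ^ (l + 1) = u * E := by rw [Real.rpow_add hE0, Real.rpow_one]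
  have hvE : E⁻¹ ^ (l + 1) = v * E⁻¹ := by
    rw [Real.inv_rpow hE0.le, Real.rpow_add hE0, Real.rpow_one, mul_inv, hv, Real.rpow_neg hE0.le]
  have hb0 : 0 ≤ (u - v) / (E - E⁻¹) := div_nonneg (by linarith) hD.le
  -- The chord at `r = 1`: the mean of `r ^ (l + 1)` for a ratio on the two endpoints with mean `1`,
  -- that is, the randomized response moment. The next two identities are the chord's values at
  -- `E⁻¹` and `E`.
  have key : (u * E - v * E⁻¹) / (E - E⁻¹) - (u - v) / (E - E⁻¹) =
      (E * u + v) / (1 + E) := by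
    have : E ^ 2 - 1 ≠ 0 := by nlinarith
    have h3 : E - E⁻¹ = (E ^ 2 - 1) / E := by field_simp
    rw [← sub_div, h3]
    field_simp
    ring
  have hid : (u * E - v * E⁻¹) / (E - E⁻¹) * E⁻¹ - (u - v) / (E - E⁻¹) = v * E⁻¹ := by
    rw [div_mul_eq_mul_div, ← sub_div, div_eq_iff hD.ne']
    field_simp
    ring
  have hid' : (u * E - v * E⁻¹) / (E - E⁻¹) * E - (u - v) / (E - E⁻¹) = u * E := by
    rw [div_mul_eq_mul_div, ← sub_div, div_eq_iff hD.ne']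
    field_simp
    ring
  refine ⟨(u * E - v * E⁻¹) / (E - E⁻¹), (u - v) / (E - E⁻¹), hb0, ?_, key, ?_, ?_⟩
  · have : 0 ≤ (E * u + v) / (1 + E) := by positivity
    linarith
  · have : 0 ≤ v * E⁻¹ := by positivity
    linarith
  · intro r hr1 hr2
    have hconv := @(convexOn_rpow (p := l + 1) (by linarith)).2 E⁻¹
      (by simp only [Set.mem_Ici]; positivity) E (by simp only [Set.mem_Ici]; positivity)
      ((E - r) / (E - E⁻¹)) ((r - E⁻¹) / (E - E⁻¹))
      (div_nonneg (by linarith) hD.le) (div_nonneg (by linarith) hD.le)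
      (by rw [← add_div, div_eq_one_iff_eq hD.ne']; ring)
    have hr : (E - r) / (E - E⁻¹) * E⁻¹ + (r - E⁻¹) / (E - E⁻¹) * E = r := by
      rw [div_mul_eq_mul_div, div_mul_eq_mul_div, ← add_div, div_eq_iff hD.ne']
      ring
    have hone : (E - r) / (E - E⁻¹) + (r - E⁻¹) / (E - E⁻¹) = 1 := by
      rw [← add_div, div_eq_one_iff_eq hD.ne']; ring
    simp only [smul_eq_mul] at hconv
    rw [hr, hvE, huE] at hconv
    refine hconv.trans (le_of_eq ?_)
    linear_combination (u * E - v * E⁻¹) / (E - E⁻¹) * hr - (u - v) / (E - E⁻¹) * hone -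
      (E - r) / (E - E⁻¹) * hid - (r - E⁻¹) / (E - E⁻¹) * hid'

/-- Homogeneous form of the chord bound. -/
theorem rpow_succ_le_of_chord {E l a b x y : ℝ} (hE : 1 < E)
    (h : ∀ r, E⁻¹ ≤ r → r ≤ E → r ^ (l + 1) ≤ a * r - b) (hx : 0 < x) (hy : 0 < y)
    (hxy : x ≤ E * y) (hyx : y ≤ E * x) :
    x ^ (l + 1) ≤ (a * x - b * y) * y ^ l := by
  have h1 := h (x / y) (by
    rw [inv_le_comm₀ (by linarith) (by positivity), inv_div, div_le_iff₀ hx]; exact hyx)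
    (by rw [div_le_iff₀ hy]; exact hxy)
  rw [Real.div_rpow hx.le hy.le, div_le_iff₀ (by positivity), Real.rpow_add hy, Real.rpow_one] at h1
  calc _ ≤ _ := h1
    _ = _ := by field_simp

/-! ### Truncated densities -/

/-- Between two functions on a discrete space there is one of any prescribed intermediate sum. -/
theorem exists_between_tsum_eq {Ω : Type*} {f g : Ω → ℝ≥0∞} {m : ℝ≥0∞} (hfg : f ≤ g)
    (hf : ∑' x, f x ≤ m) (hg : m ≤ ∑' x, g x) (hgtop : ∑' x, g x ≠ ∞) :
    ∃ h : Ω → ℝ≥0∞, f ≤ h ∧ h ≤ g ∧ ∑' x, h x = m := by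
  have hadd : ∑' x, f x + ∑' x, (g x - f x) = ∑' x, g x := by
    rw [← ENNReal.tsum_add]
    exact tsum_congr fun x => add_tsub_cancel_of_le (hfg x)
  set D := ∑' x, (g x - f x) with hD
  have hDtop : D ≠ ∞ := ne_top_of_le_ne_top hgtop (hadd ▸ le_add_self)
  have hms : m - ∑' x, f x ≤ D := tsub_le_iff_left.2 (hadd ▸ hg)
  have hs1 : (m - ∑' x, f x) / D ≤ 1 := ENNReal.div_le_of_le_mul (by rwa [one_mul])
  have hmul : (m - ∑' x, f x) / D * D = m - ∑' x, f x := by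
    by_cases h0 : D = 0
    · rw [h0, mul_zero]
      exact (le_zero_iff.1 (h0 ▸ hms)).symm
    · exact ENNReal.div_mul_cancel h0 hDtop
  refine ⟨fun x => f x + (m - ∑' x, f x) / D * (g x - f x), fun x => le_self_add, fun x => ?_, ?_⟩
  · calc f x + (m - ∑' x, f x) / D * (g x - f x) ≤ f x + 1 * (g x - f x) := by gcongr
      _ = g x := by rw [one_mul, add_tsub_cancel_of_le (hfg x)]
  · rw [ENNReal.tsum_add, ENNReal.tsum_mul_left, ← hD, hmul, add_tsub_cancel_of_le hf]

/-- Testing the event where `p` exceeds `exp ε * q` shows that clipping `p` at `exp ε * q` removes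
mass at most `δ`. -/
theorem DPClose.one_le_tsum_inf {Ω : Type*} {ε δ : ℝ} {p q : PMF Ω} (h : DPClose ε δ p q) :
    1 ≤ ∑' x, min (p x) (ENNReal.ofReal (Real.exp ε) * q x) + ENNReal.ofReal δ := by
  set c := ENNReal.ofReal (Real.exp ε)
  set A : Set Ω := {x | c * q x < p x}
  have h1 : ∑' x, min (p x) (c * q x) =
      ∑' x, Aᶜ.indicator p x + c * ∑' x, A.indicator q x := by
    rw [← ENNReal.tsum_mul_left, ← ENNReal.tsum_add]
    refine tsum_congr fun x => ?_
    by_cases hx : x ∈ A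
    · have hx' : c * q x < p x := hx
      simp [hx, hx'.le]
    · have hx' : p x ≤ c * q x := not_lt.1 hx
      simp [hx, hx']
  have h2 := h A
  rw [PMF.toOuterMeasure_apply, PMF.toOuterMeasure_apply] at h2
  calc 1 = ∑' x, p x := p.tsum_coe.symm
    _ = ∑' x, Aᶜ.indicator p x + ∑' x, A.indicator p x := by
        rw [← ENNReal.tsum_add]
        refine tsum_congr fun x => ?_
        by_cases hx : x ∈ A <;> simp [hx]
    _ ≤ ∑' x, Aᶜ.indicator p x + (c * ∑' x, A.indicator q x + ENNReal.ofReal δ) := by gcongr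
    _ = _ := by rw [h1, add_assoc]

/-- Up to mass `d`, the distribution `p` has a density whose likelihood ratio to `q` has
`l`-th moment at most `φ`. -/
def HasMomentBound {Ω : Type*} (l : ℝ) (d φ : ℝ≥0∞) (p q : PMF Ω) : Prop :=
  ∃ p' w : Ω → ℝ≥0∞, (∀ x, p' x ≤ p x) ∧ (∀ x, p' x ^ (l + 1) ≤ w x * q x ^ l) ∧
    1 ≤ ∑' x, p' x + d ∧ ∑' x, w x ≤ φ

theorem hasMomentBound_pure {Ω : Type*} (a : Ω) {l : ℝ} (hl : 0 < l) (d : ℝ≥0∞) :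
    HasMomentBound l d 1 (PMF.pure a) (PMF.pure a) := by
  refine ⟨PMF.pure a, PMF.pure a, fun x => le_rfl, fun x => ?_, ?_, ?_⟩
  · by_cases hx : x = a
    · simp [PMF.pure_apply, hx]
    · simp [PMF.pure_apply, hx, hl, show 0 < l + 1 by linarith]
  · rw [PMF.tsum_coe]
    exact le_self_add
  · rw [PMF.tsum_coe]

/-- Markov's inequality in pointwise form: where `p'` exceeds `exp ε * q`, the moment inequality
forces `p' ≤ w * exp (-(l * ε))`, and these bounds sum to at most `δ'`. The mass `d` missing from
`p'` is added at the end. -/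
theorem HasMomentBound.dpClose {Ω : Type*} {l : ℝ} (hl : 0 < l) {d : ℝ≥0∞} {φ ε δ δ' : ℝ}
    {p q : PMF Ω} (h : HasMomentBound l d (ENNReal.ofReal φ) p q)
    (hφ : φ * Real.exp (-(l * ε)) ≤ δ') (hd : d + ENNReal.ofReal δ' ≤ ENNReal.ofReal δ) :
    DPClose ε δ p q := by
  obtain ⟨p', w, hp, hw, hm, hs⟩ := h
  intro A
  set c := ENNReal.ofReal (Real.exp ε) with hc
  set k := ENNReal.ofReal (Real.exp (-(l * ε))) with hk
  have hck : c ^ l * k = 1 := by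
    rw [hc, hk, ENNReal.ofReal_rpow_of_pos (Real.exp_pos _), ← ENNReal.ofReal_mul (by positivity),
      ← Real.exp_mul, ← Real.exp_add]
    simp [mul_comm]
  have hpt : ∀ x, p' x ≤ c * q x + w x * k := by
    intro x
    by_cases hx : p' x ≤ c * q x
    · exact hx.trans le_self_add
    push Not at hx
    refine le_trans ?_ le_add_self
    have h0 : p' x ≠ 0 := (bot_le.trans_lt hx).ne'
    have htop : p' x ≠ ∞ := ne_top_of_le_ne_top (p.apply_ne_top x) (hp x)
    have hr0 : p' x ^ l ≠ 0 := (ENNReal.rpow_pos (pos_iff_ne_zero.2 h0) htop).ne'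
    have hrtop : p' x ^ l ≠ ∞ := ENNReal.rpow_ne_top_of_nonneg hl.le htop
    have h1 := hw x
    rw [ENNReal.rpow_add _ _ h0 htop, ENNReal.rpow_one] at h1
    have h2 : (c * q x) ^ l ≤ p' x ^ l := ENNReal.rpow_le_rpow hx.le hl.le
    rw [ENNReal.mul_rpow_of_nonneg _ _ hl.le] at h2
    have h3 : p' x ^ l * p' x ≤ p' x ^ l * (w x * k) := by
      calc p' x ^ l * p' x ≤ w x * q x ^ l := h1
        _ = w x * q x ^ l * (c ^ l * k) := by rw [hck, mul_one]
        _ = (c ^ l * q x ^ l) * (w x * k) := by ring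
        _ ≤ _ := by gcongr
    exact (ENNReal.mul_le_mul_iff_right hr0 hrtop).1 h3
  have hdef : ∑' x, (p x - p' x) ≤ d := by
    have hadd : ∑' x, p' x + ∑' x, (p x - p' x) = 1 := by
      rw [← ENNReal.tsum_add, ← p.tsum_coe]
      exact tsum_congr fun x => add_tsub_cancel_of_le (hp x)
    rw [← hadd] at hm
    refine (ENNReal.add_le_add_iff_left ?_).1 hm
    exact ne_top_of_le_ne_top ENNReal.one_ne_top (hadd ▸ le_self_add)
  rw [PMF.toOuterMeasure_apply, PMF.toOuterMeasure_apply, ← ENNReal.tsum_mul_left]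
  calc ∑' x, A.indicator p x
      ≤ ∑' x, (c * A.indicator q x + w x * k + (p x - p' x)) := by
        refine ENNReal.tsum_le_tsum fun x => ?_
        by_cases hx : x ∈ A
        · simp only [hx, Set.indicator_of_mem]
          calc p x = p' x + (p x - p' x) := (add_tsub_cancel_of_le (hp x)).symm
            _ ≤ _ := by gcongr; exact hpt x
        · simp [hx]
    _ = ∑' x, c * A.indicator q x + (∑' x, w x) * k + ∑' x, (p x - p' x) := by
        rw [ENNReal.tsum_add, ENNReal.tsum_add, ENNReal.tsum_mul_right]
    _ ≤ ∑' x, c * A.indicator q x + ENNReal.ofReal φ * k + d := by gcongr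
    _ ≤ ∑' x, c * A.indicator q x + ENNReal.ofReal δ' + d := by
        gcongr
        rw [hk, ← ENNReal.ofReal_mul' (Real.exp_pos _).le]
        exact ENNReal.ofReal_le_ofReal hφ
    _ ≤ _ := by
        rw [add_assoc, add_comm (ENNReal.ofReal δ')]
        gcongr

/-- Distributions that are `(ε, δ)`-indistinguishable in both directions have the moments of
randomized response. -/
theorem DPClose.hasMomentBound {Ω : Type*} {ε δ l : ℝ} (hε : 0 < ε) (hl : 0 < l) {p q : PMF Ω}
    (hpq : DPClose ε δ p q) (hqp : DPClose ε δ q p) :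
    HasMomentBound l (ENNReal.ofReal δ)
      (ENNReal.ofReal (Real.exp (l * ε * (Real.exp ε - 1) + (l * ε) ^ 2 / 2))) p q := by
  set E := Real.exp ε with hE
  have hE1 : 1 < E := Real.one_lt_exp_iff.2 hε
  set c := ENNReal.ofReal E with hc
  have hc1 : 1 ≤ c := ENNReal.one_le_ofReal.2 hE1.le
  have hctop : c ≠ ∞ := ENNReal.ofReal_ne_top
  obtain ⟨a, b, hb, hba, hab, hbE, hchord⟩ := exists_chord_bound hE1 hl.le
  -- Mutual clipping bounds both ratios of `P` and `Q` by `c`, but their masses may differ.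
  set P : Ω → ℝ≥0∞ := fun x => min (p x) (c * q x) with hP
  set Q : Ω → ℝ≥0∞ := fun x => min (q x) (c * p x) with hQ
  have hPp : ∀ x, P x ≤ p x := fun x => min_le_left _ _
  have hQq : ∀ x, Q x ≤ q x := fun x => min_le_left _ _
  have hPQ : ∀ x, P x ≤ c * Q x := fun x => by
    rw [hQ, mul_min]
    refine le_min (min_le_right _ _) ((hPp x).trans ?_)
    calc p x = 1 * (1 * p x) := by simp
      _ ≤ _ := by gcongr
  have hQP : ∀ x, Q x ≤ c * P x := fun x => by
    rw [hP, mul_min]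
    refine le_min (min_le_right _ _) ((hQq x).trans ?_)
    calc q x = 1 * (1 * q x) := by simp
      _ ≤ _ := by gcongr
  have hPsum : ∑' x, P x ≤ 1 := p.tsum_coe ▸ ENNReal.tsum_le_tsum hPp
  -- `P` may be heavier than `Q`, while `-b` in the chord bound calls for a numerator no heavier
  -- than `Q`. Lowering `P` towards `min P Q` achieves this, keeps the ratios within `c`, and still
  -- leaves mass at least `1 - δ`.
  obtain ⟨R, hR1, hR2, hRsum⟩ := exists_between_tsum_eq (f := fun x => min (P x) (Q x)) (g := P)
    (m := min (∑' x, P x) (∑' x, Q x)) (fun x => min_le_left _ _)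
    (le_min (ENNReal.tsum_le_tsum fun x => min_le_left _ _)
      (ENNReal.tsum_le_tsum fun x => min_le_right _ _)) (min_le_left _ _)
    (ne_top_of_le_ne_top ENNReal.one_ne_top hPsum)
  have hRQ : ∀ x, R x ≤ c * Q x := fun x => (hR2 x).trans (hPQ x)
  have hQR : ∀ x, Q x ≤ c * R x := fun x => by
    refine le_trans ?_ (mul_le_mul_right (hR1 x) c)
    rw [mul_min]
    refine le_min (hQP x) ?_
    calc Q x = 1 * Q x := by simp
      _ ≤ _ := by gcongr
  have hRtop : ∀ x, R x ≠ ∞ := fun x =>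
    ne_top_of_le_ne_top (p.apply_ne_top x) ((hR2 x).trans (hPp x))
  have hQtop : ∀ x, Q x ≠ ∞ := fun x => ne_top_of_le_ne_top (q.apply_ne_top x) (hQq x)
  have hle : ∀ x, ENNReal.ofReal b * Q x ≤ ENNReal.ofReal a * R x := fun x => by
    have h1 : ENNReal.ofReal b * c ≤ ENNReal.ofReal a := by
      rw [hc, ← ENNReal.ofReal_mul hb]
      refine ENNReal.ofReal_le_ofReal ?_
      have := mul_le_mul_of_nonneg_right hbE (by linarith : (0:ℝ) ≤ E)
      rwa [inv_mul_cancel_right₀ (by linarith)] at this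
    calc _ ≤ ENNReal.ofReal b * (c * R x) := by gcongr; exact hQR x
      _ = ENNReal.ofReal b * c * R x := by ring
      _ ≤ _ := by gcongr
  have ha0 : 0 ≤ a := hb.trans hba
  refine ⟨R, fun x => ENNReal.ofReal a * R x - ENNReal.ofReal b * Q x,
    fun x => (hR2 x).trans (hPp x), fun x => ?_, ?_, ?_⟩
  · by_cases h0 : R x = 0
    · rw [h0, ENNReal.zero_rpow_of_pos (by linarith)]
      exact zero_le
    have hQ0 : Q x ≠ 0 := fun h => h0 (le_zero_iff.1 (by simpa [h] using hRQ x))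
    have hrpos : 0 < (R x).toReal := ENNReal.toReal_pos h0 (hRtop x)
    have hqpos : 0 < (Q x).toReal := ENNReal.toReal_pos hQ0 (hQtop x)
    have hrq : (R x).toReal ≤ E * (Q x).toReal := by
      have := ENNReal.toReal_mono (ENNReal.mul_ne_top hctop (hQtop x)) (hRQ x)
      rwa [ENNReal.toReal_mul, hc, ENNReal.toReal_ofReal (by linarith)] at this
    have hqr : (Q x).toReal ≤ E * (R x).toReal := by
      have := ENNReal.toReal_mono (ENNReal.mul_ne_top hctop (hRtop x)) (hQR x)
      rwa [ENNReal.toReal_mul, hc, ENNReal.toReal_ofReal (by linarith)] at this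
    have hmain := rpow_succ_le_of_chord hE1 hchord hrpos hqpos hrq hqr
    calc R x ^ (l + 1) = ENNReal.ofReal ((R x).toReal ^ (l + 1)) := by
          rw [← ENNReal.ofReal_rpow_of_pos hrpos, ENNReal.ofReal_toReal (hRtop x)]
      _ ≤ ENNReal.ofReal ((a * (R x).toReal - b * (Q x).toReal) * (Q x).toReal ^ l) :=
          ENNReal.ofReal_le_ofReal hmain
      _ = (ENNReal.ofReal a * R x - ENNReal.ofReal b * Q x) * Q x ^ l := by
          rw [ENNReal.ofReal_mul' (by positivity), ENNReal.ofReal_sub _ (by positivity),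
            ENNReal.ofReal_mul ha0, ENNReal.ofReal_mul hb, ENNReal.ofReal_toReal (hRtop x),
            ENNReal.ofReal_toReal (hQtop x), ← ENNReal.ofReal_rpow_of_pos hqpos,
            ENNReal.ofReal_toReal (hQtop x)]
      _ ≤ _ := by
          gcongr
          exact hQq x
  · rw [hRsum]
    rcases min_choice (∑' x, P x) (∑' x, Q x) with h | h <;> rw [h]
    exacts [hpq.one_le_tsum_inf, hqp.one_le_tsum_inf]
  · set m := ∑' x, R x with hm
    have hm1 : m ≤ 1 := hRsum ▸ (min_le_left _ _).trans hPsum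
    have hmQ : m ≤ ∑' x, Q x := hRsum ▸ min_le_right _ _
    have hadd : ∑' x, (ENNReal.ofReal a * R x - ENNReal.ofReal b * Q x) +
        ENNReal.ofReal b * ∑' x, Q x = ENNReal.ofReal a * m := by
      rw [← ENNReal.tsum_mul_left, ← ENNReal.tsum_add, hm, ← ENNReal.tsum_mul_left]
      exact tsum_congr fun x => tsub_add_cancel_of_le (hle x)
    have hφ := randomizedResponse_moment_le hε.le (mul_nonneg hl.le hε.le : 0 ≤ l * ε)
    have hEl : E ^ l = Real.exp (l * ε) := by rw [hE, ← Real.exp_mul, mul_comm]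
    have hEl' : E ^ (-l) = Real.exp (-(l * ε)) := by
      rw [hE, ← Real.exp_mul]; congr 1; ring
    rw [hEl, hEl'] at hab
    refine le_trans ?_ (ENNReal.ofReal_le_ofReal (hab.le.trans hφ))
    -- Here `m ≤ ∑ Q` and `0 ≤ b` give `a * m - b * ∑ Q ≤ (a - b) * m`; adding `b * m` avoids
    -- truncated subtraction.
    have hle2 : ∑' x, (ENNReal.ofReal a * R x - ENNReal.ofReal b * Q x) + ENNReal.ofReal b * m ≤
        ENNReal.ofReal (a - b) * m + ENNReal.ofReal b * m := by
      rw [← add_mul, ← ENNReal.ofReal_add (by linarith) hb, sub_add_cancel, ← hadd]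
      gcongr
    have hbm : ENNReal.ofReal b * m ≠ ∞ :=
      ENNReal.mul_ne_top ENNReal.ofReal_ne_top (ne_top_of_le_ne_top ENNReal.one_ne_top hm1)
    calc _ ≤ ENNReal.ofReal (a - b) * m := (ENNReal.add_le_add_iff_right hbm).1 hle2
      _ ≤ ENNReal.ofReal (a - b) * 1 := by gcongr
      _ = _ := mul_one _

/-! ### Composition over the rounds -/

theorem lazyEnsemble_succ_apply {X : Type*} {n : ℕ} [NeZero n] (κ : Set.Ioo (0 : ℝ) 1) (lam : ℝ)
    (L : Learner X n) (S : Sample X n) (t : ℕ) (H : Fin t → X → ℤˣ) (h : X → ℤˣ) :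
    lazyEnsemble κ lam L S (t + 1) (Fin.snoc H h) =
      lazyEnsemble κ lam L S t H * L S (normalize (lazyMeasure κ lam S t H)) h := by
  rw [lazyEnsemble, PMF.bind_apply, tsum_eq_single H]
  · rw [PMF.map_apply, tsum_eq_single h]
    · simp
    · intro h' hh'
      rw [if_neg]
      intro heq
      exact hh' (Fin.snoc_injective2 heq).2.symm
  · intro H' hH'
    rw [PMF.map_apply, ENNReal.tsum_eq_zero.2, mul_zero]
    intro h'
    rw [if_neg]
    intro heq
    exact hH' (Fin.snoc_injective2 heq).1.symm

theorem tsum_snoc {α : Type*} (t : ℕ) (f : (Fin (t + 1) → α) → ℝ≥0∞) :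
    ∑' K, f K = ∑' H : Fin t → α, ∑' h : α, f (Fin.snoc H h) := by
  rw [← (Fin.snocEquiv fun _ : Fin (t + 1) => α).tsum_eq, ENNReal.tsum_prod', ENNReal.tsum_comm]
  rfl

/-- Conditioned on the same prefix `H`, the two runs differ only in the next call to the learner, so
truncated densities and majorants `w` multiply along the rounds. The bound per round must be uniform
in `H`, which makes the composition adaptive. -/
theorem hasMomentBound_lazyEnsemble {X : Type*} {n : ℕ} [NeZero n] (κ : Set.Ioo (0 : ℝ) 1)
    (lam : ℝ) (L : Learner X n) (S S' : Sample X n) {l : ℝ} (hl : 0 < l) (d φ : ℝ≥0∞)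
    (h : ∀ t H, HasMomentBound l d φ (L S (normalize (lazyMeasure κ lam S t H)))
      (L S' (normalize (lazyMeasure κ lam S' t H)))) (t : ℕ) :
    HasMomentBound l (t * d) (φ ^ t) (lazyEnsemble κ lam L S t) (lazyEnsemble κ lam L S' t) := by
  induction t with
  | zero => simpa [lazyEnsemble] using hasMomentBound_pure (Fin.elim0 : Fin 0 → X → ℤˣ) hl 0
  | succ t ih =>
    obtain ⟨P, W, hP, hW, hPm, hWs⟩ := ih
    choose p w hp hw hpm hws using h t
    refine ⟨fun K => P (Fin.init K) * p (Fin.init K) (K (Fin.last t)),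
      fun K => W (Fin.init K) * w (Fin.init K) (K (Fin.last t)), fun K => ?_, fun K => ?_, ?_, ?_⟩
    · induction K using Fin.snocCases with
      | snoc H x =>
        simp only [Fin.init_snoc, Fin.snoc_last]
        rw [lazyEnsemble_succ_apply]
        exact mul_le_mul' (hP H) (hp H x)
    · induction K using Fin.snocCases with
      | snoc H x =>
        simp only [Fin.init_snoc, Fin.snoc_last]
        rw [lazyEnsemble_succ_apply,
          ENNReal.mul_rpow_of_nonneg _ _ (by linarith), ENNReal.mul_rpow_of_nonneg _ _ hl.le,
          mul_mul_mul_comm]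
        exact mul_le_mul' (hW H) (hw H x)
    · rw [tsum_snoc]
      simp only [Fin.init_snoc, Fin.snoc_last, ENNReal.tsum_mul_left]
      have hPle : ∑' H, P H ≤ 1 := (ENNReal.tsum_le_tsum hP).trans (PMF.tsum_coe _).le
      calc (1 : ℝ≥0∞) ≤ ∑' H, P H * 1 + t * d := by simpa using hPm
        _ ≤ ∑' H, P H * (∑' x, p H x + d) + t * d := by
            gcongr with H
            exact hpm H
        _ = ∑' H, P H * ∑' x, p H x + (∑' H, P H) * d + t * d := by
            simp only [mul_add, ENNReal.tsum_add, ENNReal.tsum_mul_right]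
        _ ≤ ∑' H, P H * ∑' x, p H x + 1 * d + t * d := by gcongr
        _ = _ := by push_cast; ring
    · rw [tsum_snoc]
      simp only [Fin.init_snoc, Fin.snoc_last, ENNReal.tsum_mul_left]
      calc ∑' H, W H * ∑' x, w H x ≤ ∑' H, W H * φ := by
            gcongr with H
            exact hws H
        _ = (∑' H, W H) * φ := ENNReal.tsum_mul_right
        _ ≤ φ ^ t * φ := by gcongr
        _ = _ := (pow_succ _ _).symm

/-- Weakening of the privacy parameter. -/
theorem DPClose.mono {Ω : Type*} {ε ε' δ : ℝ} {p q : PMF Ω} (h : DPClose ε δ p q) (hε : ε ≤ ε') :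
    DPClose ε' δ p q := fun A =>
  (h A).trans (by gcongr)

theorem dpClose_of_one_le {Ω : Type*} {ε δ : ℝ} (p q : PMF Ω) (hδ : 1 ≤ δ) : DPClose ε δ p q :=
  fun A => by
    have h1 : p.toOuterMeasure A ≤ 1 := by
      rw [PMF.toOuterMeasure_apply, ← p.tsum_coe]
      exact ENNReal.tsum_le_tsum fun x => Set.indicator_le_self _ _ _
    exact h1.trans ((ENNReal.one_le_ofReal.2 hδ).trans le_add_self)

theorem DPClose.map {Ω Ω' : Type*} {ε δ : ℝ} {p q : PMF Ω} (h : DPClose ε δ p q) (f : Ω → Ω') :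
    DPClose ε δ (p.map f) (q.map f) := fun A => by
  rw [PMF.toOuterMeasure_map_apply, PMF.toOuterMeasure_map_apply]
  exact h _

/-- Indistinguishability is closed in the privacy parameter. -/
theorem dpClose_of_tendsto {Ω : Type*} {δ ε₀ : ℝ} {p q : PMF Ω} (F : ℝ → ℝ)
    (hF : Filter.Tendsto F (nhdsWithin 0 (Set.Ioi 0)) (nhds ε₀))
    (h : ∀ ε, 0 < ε → DPClose (F ε) δ p q) : DPClose ε₀ δ p q := fun A => by
  have hq : q.toOuterMeasure A ≠ ∞ := by
    rw [PMF.toOuterMeasure_apply]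
    exact q.tsum_coe_indicator_ne_top A
  have hlim : Filter.Tendsto (fun ε => ENNReal.ofReal (Real.exp (F ε)) * q.toOuterMeasure A +
      ENNReal.ofReal δ) (nhdsWithin 0 (Set.Ioi 0))
      (nhds (ENNReal.ofReal (Real.exp ε₀) * q.toOuterMeasure A + ENNReal.ofReal δ)) := by
    refine Filter.Tendsto.add ?_ tendsto_const_nhds
    refine ENNReal.Tendsto.mul_const ?_ (Or.inr hq)
    exact ENNReal.tendsto_ofReal ((Real.continuous_exp.tendsto _).comp hF)
  refine ge_of_tendsto hlim ?_
  filter_upwards [self_mem_nhdsWithin] with ε hε using h ε hε A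

/-- Advanced composition for the rounds of `LazyBB`. -/
theorem dpClose_lazyEnsemble {X : Type*} {n : ℕ} [NeZero n] (κ : Set.Ioo (0 : ℝ) 1)
    (lam : ℝ) (L : Learner X n) (S S' : Sample X n) {ε δ δ' : ℝ} {τ : ℕ} (hτ : 0 < τ) (hε : 0 ≤ ε)
    (hδ : 0 ≤ δ) (hδ' : 0 < δ')
    (h : ∀ t H, DPClose ε δ (L S (normalize (lazyMeasure κ lam S t H)))
      (L S' (normalize (lazyMeasure κ lam S' t H))))
    (h' : ∀ t H, DPClose ε δ (L S' (normalize (lazyMeasure κ lam S' t H)))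
      (L S (normalize (lazyMeasure κ lam S t H)))) :
    DPClose (√(2 * τ * Real.log (1 / δ')) * ε + τ * ε * (Real.exp ε - 1)) (τ * δ + δ')
      (lazyEnsemble κ lam L S τ) (lazyEnsemble κ lam L S' τ) := by
  have hτ0 : (0 : ℝ) < τ := by exact_mod_cast hτ
  rcases le_or_gt 1 δ' with h1 | h1
  · exact dpClose_of_one_le _ _ (by nlinarith [mul_nonneg hτ0.le hδ])
  have hpos : ∀ ε' : ℝ, 0 < ε' → ε ≤ ε' →
      DPClose (√(2 * τ * Real.log (1 / δ')) * ε' + τ * ε' * (Real.exp ε' - 1)) (τ * δ + δ')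
      (lazyEnsemble κ lam L S τ) (lazyEnsemble κ lam L S' τ) := by
    intro e he hle
    have hlog : 0 < Real.log (1 / δ') := Real.log_pos (by rw [lt_div_iff₀ hδ']; linarith)
    set r := √(2 * τ * Real.log (1 / δ')) with hr
    have hr0 : 0 < r := Real.sqrt_pos.2 (by positivity)
    have hr2 : r ^ 2 = 2 * τ * Real.log (1 / δ') := Real.sq_sqrt (by positivity)
    -- With `s = l * e`, the exponent left after cancellation is `τ * s ^ 2 / 2 - s * r`. It is
    -- minimal at `s = r / τ`, where it equals `-log (1 / δ')`.
    set l := r / (τ * e) with hl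
    have hl0 : 0 < l := by positivity
    have hle' : l * e * τ = r := by rw [hl]; field_simp
    have hm := hasMomentBound_lazyEnsemble κ lam L S S' hl0 _ _
      (fun t H => ((h t H).mono hle).hasMomentBound he hl0 ((h' t H).mono hle)) τ
    rw [← ENNReal.ofReal_pow (Real.exp_pos _).le] at hm
    refine hm.dpClose hl0 (δ' := δ') ?_ ?_
    · rw [← Real.exp_nat_mul, ← Real.exp_add]
      have hexp : τ * (l * e * (Real.exp e - 1) + (l * e) ^ 2 / 2) +
          -(l * (r * e + τ * e * (Real.exp e - 1))) = -Real.log (1 / δ') := by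
        have hs : l * e = r / τ := by rw [← hle']; field_simp
        have e1 : τ * (l * e * (Real.exp e - 1) + (l * e) ^ 2 / 2) +
          -(l * (r * e + τ * e * (Real.exp e - 1))) = τ * (l * e) ^ 2 / 2 - (l * e) * r := by ring
        rw [e1, hs]
        field_simp
        linarith
      rw [hexp, Real.exp_neg, Real.exp_log (by positivity)]
      simp
    · rw [← ENNReal.ofReal_natCast, ← ENNReal.ofReal_mul (by positivity),
        ← ENNReal.ofReal_add (by positivity) hδ'.le]
  -- At `ε = 0` the order `l` would be infinite, so this case is a limit of positive parameters.
  rcases hε.eq_or_lt with rfl | hε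
  · refine dpClose_of_tendsto (fun e => √(2 * τ * Real.log (1 / δ')) * e +
      τ * e * (Real.exp e - 1)) ?_ fun e he => hpos e he he.le
    refine Filter.Tendsto.mono_left ?_ nhdsWithin_le_nhds
    exact Continuous.tendsto (by fun_prop) 0
  · exact hpos ε hε le_rfl

/-! ### Bregman projections onto the dense measures -/

/-- `μ` is obtained from `ν` by scaling up and truncating at `1`; the scaling is nontrivial only
if the mass of `μ` is exactly `κ n`. -/
def IsTruncation {n : ℕ} (κ : ℝ) (ν μ : Fin n → ℝ) : Prop :=
  ∃ c : ℝ, 1 ≤ c ∧ (∀ i, μ i = min 1 (c * ν i)) ∧ (c = 1 ∨ ∑ i, μ i = κ * n)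

theorem IsTruncation.pos {n : ℕ} {κ : ℝ} {ν μ : Fin n → ℝ} (h : IsTruncation κ ν μ)
    (hν : ∀ i, 0 < ν i) (i : Fin n) : 0 < μ i := by
  obtain ⟨c, hc, hμ, -⟩ := h
  rw [hμ]
  exact lt_min one_pos (mul_pos (by linarith) (hν i))

/-- Take `c = 1` if that is already dense. Otherwise the mass of `min 1 (c * ν)` is continuous in
`c` and reaches `n` once `c` exceeds every `(ν i)⁻¹`, so it equals `κ n` somewhere. -/
theorem exists_isTruncation {n : ℕ} {κ : ℝ} (hκ : κ ≤ 1) {ν : Fin n → ℝ} (hν : ∀ i, 0 < ν i) :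
    ∃ μ ∈ denseMeasures n κ, IsTruncation κ ν μ := by
  set f : ℝ → ℝ := fun c => ∑ i, min 1 (c * ν i) with hf
  have hmem : ∀ c, 1 ≤ c → κ * n ≤ f c → (fun i => min 1 (c * ν i)) ∈ denseMeasures n κ :=
    fun c hc h => ⟨fun i => ⟨(lt_min one_pos (mul_pos (by linarith) (hν i))).le,
      min_le_left _ _⟩, h⟩
  rcases le_or_gt (κ * n) (f 1) with h1 | h1
  · exact ⟨_, hmem 1 le_rfl h1, 1, le_rfl, fun i => rfl, Or.inl rfl⟩
  · set C : ℝ := 1 + ∑ i, (ν i)⁻¹ with hC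
    have hC1 : 1 ≤ C := by
      have : 0 ≤ ∑ i, (ν i)⁻¹ := Finset.sum_nonneg fun i _ => (inv_pos.2 (hν i)).le
      linarith
    have hfC : κ * n ≤ f C := by
      have : f C = n := by
        have : ∀ i, min 1 (C * ν i) = 1 := fun i => by
          refine min_eq_left ?_
          have h2 : (ν i)⁻¹ ≤ C := by
            have := Finset.single_le_sum (f := fun i => (ν i)⁻¹)
              (fun j _ => (inv_pos.2 (hν j)).le) (Finset.mem_univ i)
            linarith
          rwa [inv_le_iff_one_le_mul₀ (hν i)] at h2
        simp [hf, this]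
      rw [this]
      exact mul_le_of_le_one_left n.cast_nonneg hκ
    have hcont : Continuous f := by
      rw [hf]
      fun_prop
    obtain ⟨c, hc, hfc⟩ := intermediate_value_Icc hC1 hcont.continuousOn ⟨h1.le, hfC⟩
    exact ⟨_, hmem c hc.1 hfc.ge, c, hc.1, fun i => rfl, Or.inr hfc⟩

theorem klMeasure_term {x y : ℝ} (hy : 0 < y) :
    x * Real.log (x / y) + y - x = y * InformationTheory.klFun (x / y) := by
  rw [InformationTheory.klFun_apply]
  field_simp

theorem klMeasure_nonneg {n : ℕ} {μ ν : Fin n → ℝ} (hμ : ∀ i, 0 ≤ μ i) (hν : ∀ i, 0 < ν i) :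
    0 ≤ klMeasure μ ν :=
  Finset.sum_nonneg fun i _ => by
    rw [klMeasure_term (hν i)]
    exact mul_nonneg (hν i).le (InformationTheory.klFun_nonneg (div_nonneg (hμ i) (hν i).le))

theorem eq_of_klMeasure_nonpos {n : ℕ} {μ ν : Fin n → ℝ} (hμ : ∀ i, 0 ≤ μ i) (hν : ∀ i, 0 < ν i)
    (h : klMeasure μ ν ≤ 0) : μ = ν := by
  have hnn : ∀ i ∈ Finset.univ, 0 ≤ μ i * Real.log (μ i / ν i) + ν i - μ i := fun i _ => by
    rw [klMeasure_term (hν i)]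
    exact mul_nonneg (hν i).le (InformationTheory.klFun_nonneg (div_nonneg (hμ i) (hν i).le))
  have h0 := (Finset.sum_eq_zero_iff_of_nonneg hnn).1 (le_antisymm h (klMeasure_nonneg hμ hν))
  funext i
  have hi := h0 i (Finset.mem_univ i)
  rw [klMeasure_term (hν i), mul_eq_zero, or_iff_right (hν i).ne',
    InformationTheory.klFun_eq_zero_iff (div_nonneg (hμ i) (hν i).le),
    div_eq_one_iff_eq (hν i).ne'] at hi
  exact hi

/-- The Pythagorean inequality for Bregman projections onto the dense measures. -/
theorem IsTruncation.klMeasure_add_le {n : ℕ} {κ : ℝ} {ν μ x : Fin n → ℝ}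
    (h : IsTruncation κ ν μ) (hν : ∀ i, 0 < ν i) (hx : x ∈ denseMeasures n κ) :
    klMeasure μ ν + klMeasure x μ ≤ klMeasure x ν := by
  have hμ0 := h.pos hν
  obtain ⟨c, hc, hμ, hsum⟩ := h
  have hterm : ∀ i, (x i * Real.log (x i / ν i) + ν i - x i) -
      (μ i * Real.log (μ i / ν i) + ν i - μ i) - (x i * Real.log (x i / μ i) + μ i - x i) =
      (x i - μ i) * Real.log (μ i / ν i) := fun i => by
    rcases (hx.1 i).1.eq_or_lt with h0 | h0
    · simp [← h0]
      ring
    · rw [Real.log_div h0.ne' (hν i).ne', Real.log_div h0.ne' (hμ0 i).ne',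
        Real.log_div (hμ0 i).ne' (hν i).ne']
      ring
  -- This is complementary slackness: `μ / ν` equals `c` except where `μ` is cut off at `1`; there
  -- the ratio is at most `c` and `x - μ` is nonpositive.
  have hge : ∀ i, (x i - μ i) * Real.log c ≤ (x i - μ i) * Real.log (μ i / ν i) := fun i => by
    rcases le_total 1 (c * ν i) with h1 | h1
    · have hm : μ i = 1 := by rw [hμ, min_eq_left h1]
      refine mul_le_mul_of_nonpos_left ?_ (by linarith [(hx.1 i).2])
      refine Real.log_le_log (div_pos (hμ0 i) (hν i)) ?_
      rwa [hm, div_le_iff₀ (hν i)]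
    · have hm : μ i = c * ν i := by rw [hμ, min_eq_right h1]
      rw [hm, mul_div_cancel_right₀ _ (hν i).ne']
  have htot : 0 ≤ ∑ i, (x i - μ i) * Real.log c := by
    rw [← Finset.sum_mul, Finset.sum_sub_distrib]
    rcases hsum with rfl | hs
    · simp
    · exact mul_nonneg (by linarith [hx.2]) (Real.log_nonneg hc)
  have := htot.trans (Finset.sum_le_sum fun i _ => hge i)
  rw [← Finset.sum_congr rfl fun i _ => hterm i, Finset.sum_sub_distrib,
    Finset.sum_sub_distrib] at this
  unfold klMeasure
  linarith

/-- The Pythagorean inequality leaves divergence zero between any minimizer and the truncation, so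
the chosen minimizer is the truncation. -/
theorem isTruncation_bregmanProj {n : ℕ} (κ : Set.Ioo (0 : ℝ) 1) {ν : Fin n → ℝ}
    (hν : ∀ i, 0 < ν i) : IsTruncation κ ν (bregmanProj n κ ν).1 := by
  obtain ⟨μ, hμ, ht⟩ := exists_isTruncation κ.2.2.le hν
  have hmin := (exists_bregmanProj n κ ν).choose_spec.2 μ hμ
  have hpyth := ht.klMeasure_add_le hν (bregmanProj n κ ν).2
  have heq : (bregmanProj n κ ν).1 = μ :=
    eq_of_klMeasure_nonpos (fun i => ((bregmanProj n κ ν).2.1 i).1) (ht.pos hν)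
      (by change klMeasure (bregmanProj n κ ν).1 ν ≤ _ at hmin; linarith)
  rwa [heq]

/-- The unprojected weights of `LazyBB`. -/
noncomputable def lazyWeight {X : Type*} {n t : ℕ} (κ lam : ℝ) (S : Sample X n)
    (H : Fin t → X → ℤˣ) (i : Fin n) : ℝ :=
  Real.exp (-lam * margin H (S i)) * κ

theorem lazyWeight_pos {X : Type*} {n t : ℕ} (κ : Set.Ioo (0 : ℝ) 1) (lam : ℝ) (S : Sample X n)
    (H : Fin t → X → ℤˣ) (i : Fin n) : 0 < lazyWeight κ lam S H i :=
  mul_pos (Real.exp_pos _) κ.2.1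

theorem isTruncation_lazyMeasure {X : Type*} {n : ℕ} (κ : Set.Ioo (0 : ℝ) 1) (lam : ℝ)
    (S : Sample X n) (t : ℕ) (H : Fin t → X → ℤˣ) :
    IsTruncation κ (lazyWeight κ lam S H) (lazyMeasure κ lam S t H).1 := by
  cases t with
  | zero =>
    refine ⟨1, le_rfl, fun i => ?_, Or.inl rfl⟩
    simp [lazyMeasure, lazyWeight, margin, κ.2.2.le]
  | succ t => exact isTruncation_bregmanProj κ (lazyWeight_pos κ lam S H)

/-! ### Stability of the projection under a change of one record -/

theorem statDist_comm {n : ℕ} (μ ν : Dist n) : statDist μ ν = statDist ν μ := by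
  simp only [statDist, abs_sub_comm]

/-- Since `p - q` sums to zero and is nonnegative away from `i`, no event can gain more than the
transfer at `i`. -/
theorem statDist_le_of_forall_ne {n : ℕ} {p q : Dist n} {i : Fin n}
    (h : ∀ j, j ≠ i → q.1 j ≤ p.1 j) : statDist p q ≤ q.1 i - p.1 i := by
  have hcompl : ∀ A : Finset (Fin n), i ∉ A → |∑ j ∈ A, (p.1 j - q.1 j)| ≤ q.1 i - p.1 i := by
    intro A hA
    have hne : ∀ j ∈ A, j ≠ i := fun j hj hji => hA (hji ▸ hj)
    rw [abs_of_nonneg (Finset.sum_nonneg fun j hj => sub_nonneg.2 (h j (hne j hj)))]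
    have h1 : ∑ j ∈ A, (p.1 j - q.1 j) ≤ ∑ j ∈ Finset.univ.erase i, (p.1 j - q.1 j) :=
      Finset.sum_le_sum_of_subset_of_nonneg
        (fun j hj => Finset.mem_erase.2 ⟨hne j hj, Finset.mem_univ j⟩)
        fun j hj _ => sub_nonneg.2 (h j (Finset.mem_erase.1 hj).1)
    have h2 := Finset.add_sum_erase Finset.univ (fun j => p.1 j - q.1 j) (Finset.mem_univ i)
    have h3 : ∑ j, (p.1 j - q.1 j) = 0 := by
      rw [Finset.sum_sub_distrib, p.2.2, q.2.2, sub_self]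
    rw [h3] at h2
    linarith
  refine ciSup_le fun A => ?_
  rw [← Finset.sum_sub_distrib]
  by_cases hA : i ∈ A
  · have h3 : ∑ j ∈ A, (p.1 j - q.1 j) = -∑ j ∈ Aᶜ, (p.1 j - q.1 j) := by
      rw [eq_neg_iff_add_eq_zero, Finset.sum_add_sum_compl, Finset.sum_sub_distrib, p.2.2, q.2.2,
        sub_self]
    rw [h3, abs_neg]
    exact hcompl _ (by simpa using hA)
  · exact hcompl A hA

/-- Strictness, which the learner's guarantee needs, comes from the positive mass that `μ` keeps at
`i`. -/
theorem statDist_normalize_lt {n : ℕ} [NeZero n] {κ : Set.Ioo (0 : ℝ) 1}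
    {μ μ' : denseMeasures n κ} {i : Fin n} (hi : 0 < μ.1 i) (h : ∀ j, j ≠ i → μ'.1 j ≤ μ.1 j)
    (hsum : ∑ j, μ.1 j ≤ ∑ j, μ'.1 j) :
    statDist (normalize μ) (normalize μ') < 1 / ((κ : ℝ) * n) := by
  have hn : (0 : ℝ) < n := by exact_mod_cast Nat.pos_of_ne_zero (NeZero.ne n)
  have hκn : 0 < (κ : ℝ) * n := mul_pos κ.2.1 hn
  have hs : 0 < ∑ j, μ.1 j := hκn.trans_le μ.2.2
  refine (statDist_le_of_forall_ne (i := i) fun j hj => ?_).trans_lt ?_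
  · exact div_le_div₀ (μ.2.1 j).1 (h j hj) hs hsum
  · have h1 : 0 < (normalize μ).1 i := div_pos hi hs
    have h2 : (normalize μ').1 i ≤ 1 / ((κ : ℝ) * n) :=
      div_le_div₀ zero_le_one (μ'.2.1 i).2 hκn μ'.2.2
    linarith

theorem IsTruncation.le_of_forall_ne {n : ℕ} {κ : ℝ} {ν ν' μ μ' : Fin n → ℝ} {i : Fin n}
    (h : IsTruncation κ ν μ) (h' : IsTruncation κ ν' μ') (hν : ∀ i, 0 < ν i)
    (hμ : κ * n ≤ ∑ j, μ j) (hμ' : κ * n ≤ ∑ j, μ' j) (hne : ∀ j, j ≠ i → ν j = ν' j)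
    (hi : ν i ≤ ν' i) : (∀ j, j ≠ i → μ' j ≤ μ j) ∧ ∑ j, μ j ≤ ∑ j, μ' j := by
  obtain ⟨c, hc, hμc, hs⟩ := h
  obtain ⟨c', hc', hμc', hs'⟩ := h'
  have hle : ∀ j, ν j ≤ ν' j := fun j => by
    by_cases hj : j = i
    · exact hj ▸ hi
    · exact (hne j hj).le
  have hmono : c ≤ c' → ∀ j, μ j ≤ μ' j := fun hcc j => by
    rw [hμc, hμc']
    exact min_le_min_left _ (mul_le_mul hcc (hle j) (hν j).le (by linarith))
  constructor
  · intro j hj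
    rcases le_or_gt c' c with hcc | hcc
    · rw [hμc, hμc', ← hne j hj]
      exact min_le_min_left _ (mul_le_mul_of_nonneg_right hcc (hν j).le)
    · have hs2 : ∑ j, μ' j = κ * n := hs'.resolve_left (by linarith)
      have heq := (Finset.sum_eq_sum_iff_of_le fun j _ => hmono hcc.le j).1
        (le_antisymm (Finset.sum_le_sum fun j _ => hmono hcc.le j) (hs2 ▸ hμ))
      exact (heq j (Finset.mem_univ j)).ge
  · rcases hs with rfl | hs
    · exact Finset.sum_le_sum fun j _ => hmono hc' j
    · exact hs ▸ hμ'

theorem statDist_lazyMeasure_lt {X : Type*} {n : ℕ} [NeZero n] (κ : Set.Ioo (0 : ℝ) 1) (lam : ℝ)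
    {S S' : Sample X n} (hS : Neighboring S S') (t : ℕ) (H : Fin t → X → ℤˣ) :
    statDist (normalize (lazyMeasure κ lam S t H)) (normalize (lazyMeasure κ lam S' t H)) <
      1 / ((κ : ℝ) * n) := by
  obtain ⟨i, -, hne⟩ := hS
  have hT := isTruncation_lazyMeasure κ lam S t H
  have hT' := isTruncation_lazyMeasure κ lam S' t H
  have hν := lazyWeight_pos κ lam S H
  have hν' := lazyWeight_pos κ lam S' H
  have hw : ∀ j, j ≠ i → lazyWeight κ lam S H j = lazyWeight κ lam S' H j := fun j hj => by
    rw [lazyWeight, lazyWeight, hne j hj]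
  rcases le_total (lazyWeight κ lam S H i) (lazyWeight κ lam S' H i) with hi | hi
  · obtain ⟨h1, h2⟩ := hT.le_of_forall_ne hT' hν (lazyMeasure κ lam S t H).2.2
      (lazyMeasure κ lam S' t H).2.2 hw hi
    exact statDist_normalize_lt (hT.pos hν i) h1 h2
  · obtain ⟨h1, h2⟩ := hT'.le_of_forall_ne hT hν' (lazyMeasure κ lam S' t H).2.2
      (lazyMeasure κ lam S t H).2.2 (fun j hj => (hw j hj).symm) hi
    rw [statDist_comm]
    exact statDist_normalize_lt (hT'.pos hν' i) h1 h2

theorem Neighboring.symm {X : Type*} {n : ℕ} {S S' : Sample X n} (h : Neighboring S S') :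
    Neighboring S' S := by
  obtain ⟨i, hi, hne⟩ := h
  exact ⟨i, hi.symm, fun j hj => (hne j hj).symm⟩

theorem isDP_lazyEnsemble {X : Type*} {n : ℕ} [NeZero n] (κ : Set.Ioo (0 : ℝ) 1) (lam : ℝ)
    {L : Learner X n} {ε δ δ' : ℝ} {τ : ℕ} (hτ : 0 < τ) (hε : 0 ≤ ε) (hδ : 0 ≤ δ) (hδ' : 0 < δ')
    (hL : IsDPLearner L ε δ (1 / ((κ : ℝ) * n))) :
    IsDP (lazyEnsemble κ lam L · τ)
      (√(2 * τ * Real.log (1 / δ')) * ε + τ * ε * (Real.exp ε - 1)) (τ * δ + δ') :=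
  fun S S' hS => dpClose_lazyEnsemble κ lam L S S' hτ hε hδ hδ'
    (fun t H => hL S S' hS _ _ (statDist_lazyMeasure_lt κ lam hS t H))
    (fun t H => hL S' S hS.symm _ _ (statDist_lazyMeasure_lt κ lam hS.symm t H))

/-! ### Margins of the ensemble -/

/-- The correlation of a hypothesis with the label of an example. -/
def agreement {X : Type*} (h : X → ℤˣ) (z : X × ℤˣ) : ℤ := z.2 * h z.1

theorem agreement_eq_ite {X : Type*} (h : X → ℤˣ) (z : X × ℤˣ) :
    agreement h z = if h z.1 = z.2 then 1 else -1 := by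
  unfold agreement
  rcases Int.units_eq_one_or (h z.1) with h1 | h1 <;>
    rcases Int.units_eq_one_or z.2 with h2 | h2 <;> rw [h1, h2] <;> decide

theorem agreement_sq {X : Type*} (h : X → ℤˣ) (z : X × ℤˣ) : (agreement h z : ℝ) ^ 2 = 1 := by
  rw [agreement_eq_ite]
  split_ifs <;> simp

theorem margin_eq_init_add {X : Type*} {t : ℕ} (K : Fin (t + 1) → X → ℤˣ) (z : X × ℤˣ) :
    margin K z = margin (Fin.init K) z + agreement (K (Fin.last t)) z := by
  rw [margin, Fin.sum_univ_castSucc, mul_add]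
  rfl

theorem lazyWeight_succ {X : Type*} {n t : ℕ} (κ lam : ℝ) (S : Sample X n)
    (K : Fin (t + 1) → X → ℤˣ) (i : Fin n) :
    lazyWeight κ lam S K i = lazyWeight κ lam S (Fin.init K) i *
      Real.exp (-(lam * agreement (K (Fin.last t)) (S i))) := by
  rw [lazyWeight, lazyWeight, margin_eq_init_add, mul_right_comm, ← Real.exp_add]
  congr 2
  push_cast
  ring

theorem sum_mul_agreement_ge {X : Type*} {n : ℕ} [NeZero n] {κ : Set.Ioo (0 : ℝ) 1} {γ : ℝ}
    {S : Sample X n} {h : X → ℤˣ} {μ : denseMeasures n κ}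
    (hacc : 1 / 2 + γ ≤ accuracy S (normalize μ) h) :
    2 * γ * ∑ i, μ.1 i ≤ ∑ i, μ.1 i * agreement h (S i) := by
  have hn : (0 : ℝ) < n := by exact_mod_cast Nat.pos_of_ne_zero (NeZero.ne n)
  have hs : 0 < ∑ j, μ.1 j := (mul_pos κ.2.1 hn).trans_le μ.2.2
  have h1 : ∑ i, μ.1 i * agreement h (S i) =
      2 * ∑ i with h (S i).1 = (S i).2, μ.1 i - ∑ i, μ.1 i := by
    rw [Finset.sum_filter, Finset.mul_sum, ← Finset.sum_sub_distrib]
    refine Finset.sum_congr rfl fun i _ => ?_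
    rw [agreement_eq_ite]
    split_ifs
    · push_cast
      ring
    · push_cast
      ring
  have h2 : accuracy S (normalize μ) h = (∑ i with h (S i).1 = (S i).2, μ.1 i) / ∑ j, μ.1 j := by
    rw [accuracy, Finset.sum_div]
    rfl
  rw [h2, le_div_iff₀ hs] at hacc
  rw [h1]
  linarith

theorem accuracy_le_one {X : Type*} {n : ℕ} (S : Sample X n) (μ : Dist n) (h : X → ℤˣ) :
    accuracy S μ h ≤ 1 :=
  μ.2.2 ▸ Finset.sum_le_univ_sum_of_nonneg μ.2.1

/-- The step of multiplicative weights for a single coordinate. -/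
theorem kl_step_ge {x m a : ℝ} (hx : 0 ≤ x) (hm : 0 < m) (ha : |a| ≤ 1) :
    m * a - m * a ^ 2 ≤ x * Real.log (x / m) + m - x + a * x := by
  -- The left side of the goal, as a function of `x`, is bounded by `m * (1 - exp (-a))`, its
  -- minimum at `x = m * exp (-a)`.
  have h1 : 0 ≤ x * Real.log (x / (m * Real.exp (-a))) + m * Real.exp (-a) - x := by
    rw [klMeasure_term (by positivity)]
    exact mul_nonneg (by positivity) (InformationTheory.klFun_nonneg (by positivity))
  have h2 : x * Real.log (x / (m * Real.exp (-a))) = x * Real.log (x / m) + a * x := by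
    rcases hx.eq_or_lt with rfl | hx
    · simp
    · rw [← div_div, Real.log_div (by positivity) (Real.exp_pos _).ne', Real.log_exp]
      ring
  have h3 : Real.exp (-a) ≤ 1 - a + a ^ 2 := by
    have := (abs_le.1 (Real.abs_exp_sub_one_sub_id_le (x := -a) (by rwa [abs_neg]))).2
    nlinarith
  nlinarith [mul_le_mul_of_nonneg_left h3 hm.le]

/-- Every hypothesis of the ensemble has advantage `γ` over the distribution it was trained on. -/
def AllAccurate {X : Type*} {n : ℕ} [NeZero n] (κ : Set.Ioo (0 : ℝ) 1) (lam γ : ℝ)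
    (S : Sample X n) : (t : ℕ) → (Fin t → X → ℤˣ) → Prop
  | 0, _ => True
  | t + 1, K => AllAccurate κ lam γ S t (Fin.init K) ∧
      1 / 2 + γ ≤ accuracy S (normalize (lazyMeasure κ lam S t (Fin.init K))) (K (Fin.last t))

/-- The objective that the measures of `LazyBB` minimize. -/
noncomputable def lazyObjective {X : Type*} {n t : ℕ} (κ lam : ℝ) (S : Sample X n)
    (H : Fin t → X → ℤˣ) (x : Fin n → ℝ) : ℝ :=
  klMeasure x (lazyWeight κ lam S H) - ∑ i, lazyWeight κ lam S H i + κ * n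

theorem lazyObjective_succ {X : Type*} {n t : ℕ} (κ : Set.Ioo (0 : ℝ) 1) (lam : ℝ)
    (S : Sample X n) (K : Fin (t + 1) → X → ℤˣ) {x : Fin n → ℝ} (hx : ∀ i, 0 ≤ x i) :
    lazyObjective κ lam S K x = lazyObjective κ lam S (Fin.init K) x +
      ∑ i, lam * agreement (K (Fin.last t)) (S i) * x i := by
  have hterm : ∀ i, x i * Real.log (x i / lazyWeight κ lam S K i) =
      x i * Real.log (x i / lazyWeight κ lam S (Fin.init K) i) +
        lam * agreement (K (Fin.last t)) (S i) * x i := fun i => by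
    rcases (hx i).eq_or_lt with h0 | h0
    · simp [← h0]
    · have := lazyWeight_pos κ lam S (Fin.init K) i
      rw [lazyWeight_succ, ← div_div, Real.log_div (by positivity) (Real.exp_pos _).ne',
        Real.log_exp]
      ring
  simp only [lazyObjective, klMeasure, hterm, Finset.sum_sub_distrib, Finset.sum_add_distrib]
  ring

/-- In each round the Pythagorean inequality supplies `klMeasure x μ`, where `μ` is the current
measure. This pays for replacing `x` by `μ` in the new linear term, up to `lam ^ 2 * ∑ μ`, and
against `μ` the hypothesis has advantage `γ`. -/
theorem AllAccurate.le_lazyObjective {X : Type*} {n : ℕ} [NeZero n] {κ : Set.Ioo (0 : ℝ) 1}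
    {γ lam : ℝ} {S : Sample X n} (hlam : 0 ≤ lam) (hlamγ : lam ≤ 2 * γ) {t : ℕ}
    {H : Fin t → X → ℤˣ} (h : AllAccurate κ lam γ S t H) {x : Fin n → ℝ}
    (hx : x ∈ denseMeasures n κ) :
    t * (lam * (2 * γ - lam) * (κ * n)) ≤ lazyObjective κ lam S H x := by
  induction t generalizing x with
  | zero =>
    have h0 := klMeasure_nonneg (fun i => (hx.1 i).1) (lazyWeight_pos κ lam S H)
    have h1 : ∑ i, lazyWeight κ lam S H i = κ * n := by
      simp [lazyWeight, margin, mul_comm]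
    simp only [lazyObjective, h1]
    push_cast
    linarith
  | succ t ih =>
    obtain ⟨hH, hacc⟩ := h
    set μ := lazyMeasure κ lam S t (Fin.init H) with hμ
    set ℓ : Fin n → ℝ := fun i => agreement (H (Fin.last t)) (S i) with hℓ
    -- Accuracy is at most `1`, so `γ ≤ 1 / 2`.
    have hlam1 : lam ≤ 1 := by
      have := hacc.trans (accuracy_le_one _ _ _)
      linarith
    have hT := isTruncation_lazyMeasure κ lam S t (Fin.init H)
    have hν := lazyWeight_pos κ lam S (Fin.init H)
    have hpyth := hT.klMeasure_add_le hν hx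
    have hadv := sum_mul_agreement_ge hacc
    have hih := ih hH μ.2
    have hstep : ∑ i, (μ.1 i * (lam * ℓ i) - μ.1 i * lam ^ 2) ≤
        klMeasure x μ.1 + ∑ i, lam * ℓ i * x i := by
      rw [klMeasure, ← Finset.sum_add_distrib]
      refine Finset.sum_le_sum fun i _ => ?_
      have hsq : (lam * ℓ i) ^ 2 = lam ^ 2 := by rw [mul_pow, hℓ, agreement_sq, mul_one]
      have := kl_step_ge (a := lam * ℓ i) (hx.1 i).1 (hT.pos hν i)
        (by rw [← sq_le_one_iff_abs_le_one, hsq]; exact pow_le_one₀ hlam hlam1)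
      rwa [hsq] at this
    have hsum : ∑ i, (μ.1 i * (lam * ℓ i) - μ.1 i * lam ^ 2) =
        lam * ∑ i, μ.1 i * ℓ i - lam ^ 2 * ∑ i, μ.1 i := by
      rw [Finset.sum_sub_distrib, Finset.mul_sum, Finset.mul_sum]
      congr 1 <;> exact Finset.sum_congr rfl fun i _ => by ring
    rw [hsum] at hstep
    have hgain : lam * (2 * γ - lam) * (κ * n) ≤
        lam * ∑ i, μ.1 i * ℓ i - lam ^ 2 * ∑ i, μ.1 i := by
      calc lam * (2 * γ - lam) * (κ * n) ≤ lam * (2 * γ - lam) * ∑ i, μ.1 i :=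
            mul_le_mul_of_nonneg_left μ.2.2 (mul_nonneg hlam (by linarith))
        _ = lam * (2 * γ * ∑ i, μ.1 i) - lam ^ 2 * ∑ i, μ.1 i := by ring
        _ ≤ _ := by gcongr
    rw [lazyObjective_succ κ lam S H fun i => (hx.1 i).1]
    rw [lazyObjective] at hih ⊢
    push_cast
    linarith

/-- The objective at the dense measure that is uniform on a set of examples of low margin. -/
theorem exists_dense_lazyObjective_le {X : Type*} {n t : ℕ} [NeZero n] {κ : Set.Ioo (0 : ℝ) 1}
    {lam θ : ℝ} (hlam : 0 ≤ lam) (S : Sample X n) (H : Fin t → X → ℤˣ) {E : Finset (Fin n)}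
    (hE : (κ : ℝ) * n ≤ E.card) (hm : ∀ i ∈ E, (margin H (S i) : ℝ) ≤ θ) :
    ∃ x ∈ denseMeasures n κ,
      lazyObjective κ lam S H x ≤ κ * n * (Real.log (1 / κ) + lam * θ) := by
  have hn : (0 : ℝ) < n := by exact_mod_cast Nat.pos_of_ne_zero (NeZero.ne n)
  have hκ : (0 : ℝ) < κ := κ.2.1
  have hκn : 0 < (κ : ℝ) * n := mul_pos hκ hn
  have hc : (0 : ℝ) < E.card := hκn.trans_le hE
  set a : ℝ := κ * n / E.card with ha
  have ha0 : 0 < a := by positivity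
  have hca : E.card * a = κ * n := by rw [ha]; field_simp
  have hsum : ∑ i, (if i ∈ E then a else 0) = κ * n := by
    rw [Finset.sum_ite_mem, Finset.univ_inter, Finset.sum_const, nsmul_eq_mul, hca]
  refine ⟨fun i => if i ∈ E then a else 0, ⟨fun i => ?_, hsum.ge⟩, ?_⟩
  · beta_reduce
    split_ifs
    · exact ⟨ha0.le, (div_le_one hc).2 hE⟩
    · exact ⟨le_rfl, zero_le_one⟩
  · have hterm : ∀ i, (if i ∈ E then a else 0) *
        Real.log ((if i ∈ E then a else 0) / lazyWeight κ lam S H i) ≤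
        (if i ∈ E then a else 0) * (Real.log (1 / κ) + lam * θ) := fun i => by
      split_ifs with hi
      · refine mul_le_mul_of_nonneg_left ?_ ha0.le
        have h1 : a / lazyWeight κ lam S H i = a / κ / Real.exp (-lam * margin H (S i)) := by
          rw [lazyWeight, div_div a, mul_comm (κ : ℝ)]
        rw [h1, Real.log_div (by positivity) (Real.exp_pos _).ne', Real.log_exp]
        have h2 : Real.log (a / κ) ≤ Real.log (1 / κ) :=
          Real.log_le_log (by positivity) (by gcongr; exact (div_le_one hc).2 hE)
        nlinarith [mul_le_mul_of_nonneg_left (hm i hi) hlam]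
      · simp
    have h3 := Finset.sum_le_sum fun i (_ : i ∈ Finset.univ) => hterm i
    rw [← Finset.sum_mul, hsum] at h3
    simp only [lazyObjective, klMeasure, Finset.sum_sub_distrib, Finset.sum_add_distrib, hsum]
    linarith

theorem AllAccurate.lowMarginFraction_le {X : Type*} {n : ℕ} [NeZero n] {κ : Set.Ioo (0 : ℝ) 1}
    {γ : ℝ} {S : Sample X n} (hγ : 0 < γ) {τ : ℕ}
    (hτ : 16 * Real.log (1 / (κ : ℝ)) / γ ^ 2 ≤ (τ : ℝ)) {H : Fin τ → X → ℤˣ}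
    (h : AllAccurate κ (γ / 4) γ S τ H) : lowMarginFraction S H γ ≤ κ := by
  by_contra! hlow
  have hn : (0 : ℝ) < n := by exact_mod_cast Nat.pos_of_ne_zero (NeZero.ne n)
  have hκn : 0 < (κ : ℝ) * n := mul_pos κ.2.1 hn
  have hlog : 0 < Real.log (1 / (κ : ℝ)) :=
    Real.log_pos (by rw [lt_div_iff₀ κ.2.1, one_mul]; exact κ.2.2)
  have hτ0 : (0 : ℝ) < τ := lt_of_lt_of_le (by positivity) hτ
  rw [lowMarginFraction, lt_div_iff₀ hn] at hlow
  obtain ⟨x, hx, hle⟩ := exists_dense_lazyObjective_le (lam := γ / 4) (θ := γ * τ)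
    (by positivity) S H hlow.le fun i hi => by
      rw [Finset.mem_filter] at hi
      exact (div_le_iff₀ hτ0).1 hi.2
  have hge := h.le_lazyObjective (by positivity) (by linarith) hx
  -- Comparing `7 / 16` with `4 / 16` gives `3 / 16 * γ ^ 2 * τ ≤ log (1 / κ)`, against `γ ^ 2 * τ ≥
  -- 16 * log (1 / κ) > 0`.
  have h1 : (κ * n : ℝ) * (τ * (γ / 4 * (2 * γ - γ / 4))) ≤
      κ * n * (Real.log (1 / κ) + γ / 4 * (γ * τ)) := by linarith
  have h2 := le_of_mul_le_mul_left h1 hκn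
  rw [div_le_iff₀ (by positivity)] at hτ
  nlinarith

/-- A union bound: given any prefix, a fresh call to the learner fails with probability at most `β`.
-/
theorem toOuterMeasure_not_allAccurate_le {X : Type*} {n : ℕ} [NeZero n] (κ : Set.Ioo (0 : ℝ) 1)
    (lam : ℝ) {L : Learner X n} {C : Set (X → ℤˣ)} {γ β : ℝ} (hL : IsWeakLearner L C γ β)
    {S : Sample X n} (hS : ∃ c ∈ C, ∀ i, (S i).2 = c (S i).1) (t : ℕ) :
    (lazyEnsemble κ lam L S t).toOuterMeasure {H | ¬ AllAccurate κ lam γ S t H} ≤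
      t * ENNReal.ofReal β := by
  classical
  induction t with
  | zero => simp [AllAccurate]
  | succ t ih =>
    rw [PMF.toOuterMeasure_apply] at ih ⊢
    rw [tsum_snoc]
    set P := lazyEnsemble κ lam L S t
    set Q := fun H => L S (normalize (lazyMeasure κ lam S t H))
    have hQ : ∀ H, ∑' h, {h | ¬ 1 / 2 + γ ≤
        accuracy S (normalize (lazyMeasure κ lam S t H)) h}.indicator (Q H) h ≤
        ENNReal.ofReal β := fun H => by
      rw [← PMF.toOuterMeasure_apply]
      exact hL S hS _
    calc _ ≤ ∑' H, ∑' h, ({H | ¬ AllAccurate κ lam γ S t H}.indicator P H * Q H h + P H *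
          {h | ¬ 1 / 2 + γ ≤
            accuracy S (normalize (lazyMeasure κ lam S t H)) h}.indicator (Q H) h) := by
          refine ENNReal.tsum_le_tsum fun H => ENNReal.tsum_le_tsum fun h => ?_
          by_cases hH : AllAccurate κ lam γ S t H
          · by_cases hh : 1 / 2 + γ ≤ accuracy S (normalize (lazyMeasure κ lam S t H)) h
            · rw [Set.indicator_of_notMem]
              · exact zero_le
              · simp only [Set.mem_ofPred_eq, not_not, AllAccurate, Fin.init_snoc, Fin.snoc_last]
                exact ⟨hH, hh⟩
            · refine le_trans (Set.indicator_le_self _ _ _) (le_trans ?_ le_add_self)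
              rw [lazyEnsemble_succ_apply, Set.indicator_of_mem hh]
          · refine le_trans (Set.indicator_le_self _ _ _) (le_trans ?_ le_self_add)
            rw [lazyEnsemble_succ_apply, Set.indicator_of_mem hH]
      _ = ∑' H, {H | ¬ AllAccurate κ lam γ S t H}.indicator P H + ∑' H, P H * ∑' h,
          {h | ¬ 1 / 2 + γ ≤
            accuracy S (normalize (lazyMeasure κ lam S t H)) h}.indicator (Q H) h := by
          simp only [ENNReal.tsum_add, ENNReal.tsum_mul_left, PMF.tsum_coe, mul_one]
      _ ≤ t * ENNReal.ofReal β + ∑' H, P H * ENNReal.ofReal β := by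
          gcongr with H
          exact hQ H
      _ = _ := by
          rw [ENNReal.tsum_mul_right, PMF.tsum_coe]
          push_cast
          ring

end PrivateBoosting

theorem mainTheorem3 {X : Type*} (n : ℕ) [NeZero n] (C : Set (X → ℤˣ))
    (L : PrivateBoosting.Learner X n) (κ : Set.Ioo (0 : ℝ) 1) (γ β ε_b δ_b : ℝ) (τ : ℕ)
    (hγ : 0 < γ) (hε : 0 ≤ ε_b) (hδ : 0 ≤ δ_b)
    (hDP : PrivateBoosting.IsDPLearner L ε_b δ_b (1 / ((κ : ℝ) * n)))
    (hWL : PrivateBoosting.IsWeakLearner L C γ β)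
    (hτ : 16 * Real.log (1 / (κ : ℝ)) / γ ^ 2 ≤ (τ : ℝ)) :
    -- privacy, both of the ensemble and of its majority vote
    (∀ δ' : ℝ, 0 < δ' →
      PrivateBoosting.IsDP (PrivateBoosting.lazyEnsemble κ (γ / 4) L · τ)
        (√(2 * τ * Real.log (1 / δ')) * ε_b + τ * ε_b * (Real.exp ε_b - 1)) (τ * δ_b + δ') ∧
      PrivateBoosting.IsDP (PrivateBoosting.lazyBB κ (γ / 4) τ L)
        (√(2 * τ * Real.log (1 / δ')) * ε_b + τ * ε_b * (Real.exp ε_b - 1)) (τ * δ_b + δ')) ∧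
    -- utility, on every sample labelled by a concept of `C`
    (∀ S : PrivateBoosting.Sample X n, (∃ c ∈ C, ∀ i, (S i).2 = c (S i).1) →
      (PrivateBoosting.lazyEnsemble κ (γ / 4) L S τ).toOuterMeasure
        {H | ¬ PrivateBoosting.lowMarginFraction S H γ ≤ κ} ≤ ENNReal.ofReal (τ * β)) := by
  have hlog : 0 < Real.log (1 / (κ : ℝ)) :=
    Real.log_pos (by rw [lt_div_iff₀ κ.2.1, one_mul]; exact κ.2.2)
  have hτ0 : 0 < τ := by
    have : (0 : ℝ) < τ := lt_of_lt_of_le (by positivity) hτ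
    exact_mod_cast this
  refine ⟨fun δ' hδ' => ?_, fun S hS => ?_⟩
  · have h := PrivateBoosting.isDP_lazyEnsemble κ (γ / 4) hτ0 hε hδ hδ' hDP
    exact ⟨h, fun S S' hS => (h S S' hS).map _⟩
  · have hsub : {H | ¬ PrivateBoosting.lowMarginFraction S H γ ≤ κ} ⊆
        {H | ¬ PrivateBoosting.AllAccurate κ (γ / 4) γ S τ H} := fun H hH hacc =>
      hH (PrivateBoosting.AllAccurate.lowMarginFraction_le hγ hτ hacc)
    rw [ENNReal.ofReal_mul τ.cast_nonneg, ENNReal.ofReal_natCast]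
    exact (MeasureTheory.measure_mono hsub).trans
      (PrivateBoosting.toOuterMeasure_not_allAccurate_le κ (γ / 4) hWL hS τ)
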